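/- Let $L$ be a first-order language and let $U$ be a saturated $L$-structure whose cardinality $\kappa=|U|$ is an uncountable (strongly) inaccessible cardinal with $\kappa>|L|$. (A structure $M$ is saturated if for every $A\subseteq M$ with $|A|<|M|$, every set of formulas in a finite tuple of variables with parameters in $A$ that is finitely satisfiable in $M$ is realized in $M$.) Let $n\in\mathbb N$ and let $C\subseteq U^n$ be an arbitrary subset such that the expansion $\langle U,C\rangle$ of $U$ by a new $n$-ary predicate interpreted as $C$ is a saturated structure. For $A\subseteq U$ let $o(C/A)=\{f[C] : f\in\mathrm{Aut}(U/A)\}$, where $\mathrm{Aut}(U/A)$ is the group of $L$-automorphisms of $U$ fixing $A$ pointwise. A family $F$ of subsets of $U^n$ has finite VC-dimension if there is $k<\omega$ such that no set $B\subseteq U^n$ of size $k$ is shattered by $F$, where $F$ shatters $B$ if every $H\subseteq B$ equals $D\cap B$ for some $D\in F$. **Theorem.** Suppose that $o(C/A)$ has finite VC-dimension for some $A\subseteq U$ with $|A|<\kappa$. Then $C$ is approximable from below and from above, that is: 1. (from below) there is an $L$-formula $\varphi(x,z)$ without parameters, with $x$ a finite tuple of variables and $|z|=n$, such that for every finite $B\subseteq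 U$ there is $b\in U^{|x|}$ with $\varphi(b,U)\cap B^n=C\cap B^n$ and $\varphi(b,U)\subseteq C$; 2. (from above) there is an $L$-formula $\varphi'(x',z)$ without parameters, with $x'$ a finite tuple of variables and $|z|=n$, such that for every finite $B\subseteq U$ there is $b\in U^{|x'|}$ with $\varphi'(b,U)\cap B^n=C\cap B^n$ and $C\subseteq\varphi'(b,U)$. Here $\varphi(b,U)=\{a\in U^n : U\models\varphi(b,a)\}$. -/

import Mathlib

open scoped FirstOrder
open scoped Cardinal

universe u v w

namespace ExtDef

/-- A structure `M` is saturated: for every `A ⊆ M` with `#A < #M` and every finite tuple of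
variables, every set of formulas with parameters in `A` that is finitely satisfiable in `M` is
realized in `M`. -/
def IsSaturated (L : FirstOrder.Language.{u, v}) (M : Type w) [L.Structure M] : Prop :=
  ∀ A : Set M, #A < #M → ∀ (m : ℕ) (p : Set (L[[A]].Formula (Fin m))),
    (∀ q ⊆ p, q.Finite → ∃ c : Fin m → M, ∀ φ ∈ q, φ.Realize c) →
      ∃ c : Fin m → M, ∀ φ ∈ p, φ.Realize c

/-- The only symbol of the one-predicate language: a relation symbol of arity `n`. -/
inductive PredRel (n : ℕ) : ℕ → Type
  | mem : PredRel n n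

/-- The language with a single `n`-ary relation symbol and nothing else. -/
def predLanguage (n : ℕ) : FirstOrder.Language.{0, 0} :=
  ⟨fun _ => Empty, PredRel n⟩

/-- The new predicate is interpreted as membership in `D`. -/
@[reducible] def predStructure {U : Type w} {n : ℕ} (D : Set (Fin n → U)) :
    (predLanguage n).Structure U where
  funMap := fun f => Empty.elim f
  RelMap := fun r => match r with
    | PredRel.mem => fun a => a ∈ D

/-- The expansion `⟨U, D⟩` of the `L`-structure `U` by an `n`-ary predicate for `D`. -/
@[reducible] def expansion (L : FirstOrder.Language.{u, v}) {U : Type w} [L.Structure U] {n : ℕ}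
    (D : Set (Fin n → U)) : (L.sum (predLanguage n)).Structure U :=
  letI := predStructure D
  FirstOrder.Language.sumStructure L (predLanguage n) U

/-- The set `D` is saturated: the expansion `⟨U, D⟩` is a saturated structure. -/
def IsSaturatedSet (L : FirstOrder.Language.{u, v}) {U : Type w} [L.Structure U] {n : ℕ}
    (D : Set (Fin n → U)) : Prop :=
  letI := expansion L D
  IsSaturated (L.sum (predLanguage n)) U

/-- `o(D/A)`: the orbit of `D` under the automorphisms of `U` that fix `A` pointwise. -/
def orbit (L : FirstOrder.Language.{u, v}) {U : Type w} [L.Structure U] {n : ℕ}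
    (D : Set (Fin n → U)) (A : Set U) : Set (Set (Fin n → U)) :=
  {E | ∃ f : U ≃[L] U, (∀ a ∈ A, f a = a) ∧ E = (fun c : Fin n → U => fun i => f (c i)) '' D}

/-- The family `F` shatters `B`: every `H ⊆ B` is the trace over `B` of a member of `F`. -/
def Shatters {α : Type w} (F : Set (Set α)) (B : Set α) : Prop :=
  ∀ H ⊆ B, ∃ D ∈ F, D ∩ B = H

/-- The family `F` has finite VC-dimension: for some `k`, no set of size `k` is shattered. -/
def HasFiniteVCDim {α : Type w} (F : Set (Set α)) : Prop :=
  ∃ k : ℕ, ∀ B : Finset α, B.card = k → ¬ Shatters F (B : Set α)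

/-- The set `φ(b, U) = {a | φ(b, a)}`. -/
def solutions {L : FirstOrder.Language.{u, v}} {U : Type w} [L.Structure U] {m n : ℕ}
    (φ : L.Formula (Fin m ⊕ Fin n)) (b : Fin m → U) : Set (Fin n → U) :=
  {a | φ.Realize (Sum.elim b a)}

/-- The Cartesian power `Bⁿ` of a set `B ⊆ U`. -/
def power {U : Type w} (n : ℕ) (B : Set U) : Set (Fin n → U) :=
  {a | ∀ i, a i ∈ B}

/-- `D` is approximable from below: there is a parameter-free formula `φ(x, z)` such that for
every finite `B ⊆ U` some `b` satisfies `φ(b, B) = D ∩ Bⁿ` and `φ(b, U) ⊆ D`. -/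
def ApproximableFromBelow (L : FirstOrder.Language.{u, v}) {U : Type w} [L.Structure U] {n : ℕ}
    (D : Set (Fin n → U)) : Prop :=
  ∃ (m : ℕ) (φ : L.Formula (Fin m ⊕ Fin n)), ∀ B : Set U, B.Finite →
    ∃ b : Fin m → U, solutions φ b ∩ power n B = D ∩ power n B ∧ solutions φ b ⊆ D

/-- `D` is approximable from above: there is a parameter-free formula `φ(x, z)` such that for
every finite `B ⊆ U` some `b` satisfies `φ(b, B) = D ∩ Bⁿ` and `D ⊆ φ(b, U)`. -/
def ApproximableFromAbove (L : FirstOrder.Language.{u, v}) {U : Type w} [L.Structure U] {n : ℕ}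
    (D : Set (Fin n → U)) : Prop :=
  ∃ (m : ℕ) (φ : L.Formula (Fin m ⊕ Fin n)), ∀ B : Set U, B.Finite →
    ∃ b : Fin m → U, solutions φ b ∩ power n B = D ∩ power n B ∧ D ⊆ solutions φ b

end ExtDef

/-!
Let `X` be the trace of `C` on `Bⁿ`, where `B ⊇ A` is small. The heart of the proof is that `X`
is covered by a single definable subset of `C` (`exists_definable_between`).

Suppose not. By compactness there is an ultrafilter `𝓤` on `X` that contains no definable subset
of `C` (`exists_ultrafilter_of_not_subset`). The formulas defining a member of `𝓤` form a global
type that is finitely satisfiable in `X ⊆ C`, and each of them is also satisfied outside `C`. As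
`⟨U, C⟩` is saturated, over any small set of parameters this type is realized in `C` and also
outside `C`. Hence for every pattern `s : ℕ → Prop` it has a Morley sequence `a` over `B` with
`a i ∈ C ↔ s i` (`exists_isMorleySequence`). The type is invariant over `B`, so any two such
sequences are elementarily equivalent over `B`, and by the strong homogeneity of `U`
(`IsElementary.exists_equiv`) initial segments of the same length are conjugate under
`Aut(U/B) ≤ Aut(U/A)`. Moving all patterns to one fixed sequence shows that the orbit of `C` over
`A` shatters sets of every finite size (`not_hasFiniteVCDim_orbit`).

Uniformity of the approximating formula comes for free: if every formula failed on some finite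
set, the union of these sets would be a small `B`, since there are fewer than `κ` formulas, and no
formula would work for it (`approximableFromBelow`). Approximation from above is approximation of
the complement from below, and the hypotheses on `C` pass to its complement.
-/

namespace ExtDef

open FirstOrder FirstOrder.Language Set

/-! ### Elementary relations and strong homogeneity -/

section Elementary

variable {L : FirstOrder.Language.{u, v}} {M : Type w} [L.Structure M]

theorem definable_realize_elim {ι α : Type*} {A : Set M} {t : ι → M} (ht : ∀ i, t i ∈ A)
    (ψ : L.Formula (ι ⊕ α)) : A.Definable L {z : α → M | ψ.Realize (Sum.elim t z)} := by
  refine definable_iff_exists_formula_sum.2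
    ⟨ψ.relabel (Sum.map (fun i => (⟨t i, ht i⟩ : A)) id), ?_⟩
  ext z
  simp only [mem_ofPred_eq, Formula.realize_relabel, Sum.elim_comp_map]
  rfl

/-- Saturation in terms of definable sets: a nonempty family of nonempty sets definable over a
small set of parameters has a common point as soon as it is closed under intersection. -/
theorem IsSaturated.sInter_nonempty (hM : IsSaturated L M) {A : Set M} (hA : #A < #M) {m : ℕ}
    {F : Set (Set (Fin m → M))} (hF : F.Nonempty) (hdef : ∀ D ∈ F, A.Definable L D)
    (hinter : ∀ D ∈ F, ∀ E ∈ F, D ∩ E ∈ F) (hne : ∀ D ∈ F, D.Nonempty) : (⋂₀ F).Nonempty := by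
  have key : ∀ q : Set (L[[A]].Formula (Fin m)), q.Finite → (∀ φ ∈ q, Set.ofPred φ.Realize ∈ F) →
      ∃ D ∈ F, ∀ c ∈ D, ∀ φ ∈ q, φ.Realize c := by
    intro q hq
    induction q, hq using Set.Finite.induction_on with
    | empty => exact fun _ => hF.imp fun D hD => ⟨hD, by simp⟩
    | @insert φ q _ _ ih =>
      intro h
      obtain ⟨D, hD, hDq⟩ := ih fun ψ hψ => h ψ (mem_insert_of_mem _ hψ)
      refine ⟨_, hinter _ (h φ (mem_insert _ _)) _ hD, ?_⟩
      rintro c ⟨hc, hc'⟩ ψ (rfl | hψ)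
      exacts [hc, hDq c hc' ψ hψ]
  obtain ⟨c, hc⟩ := hM A hA m {φ | Set.ofPred φ.Realize ∈ F} fun q hq hfin => by
    obtain ⟨D, hD, hDq⟩ := key q hfin hq
    exact (hne D hD).imp hDq
  refine ⟨c, fun D hD => ?_⟩
  obtain ⟨φ, rfl⟩ := hdef D hD
  exact hc φ hD

variable (L) in
/-- A relation `R` on `M`, seen as a set of pairs, is elementary if the family of its first
coordinates and the family of its second coordinates satisfy the same formulas. Since equations
are formulas, such an `R` is the graph of a partial elementary bijection. -/
def IsElementary (R : Set (M × M)) : Prop :=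
  ∀ φ : L.Formula R, φ.Realize (fun p => p.1.1) ↔ φ.Realize (fun p => p.1.2)

theorem IsElementary.realize_iff {R : Set (M × M)} (hR : IsElementary L R) {ι : Type*}
    {t : ι → M × M} (ht : ∀ i, t i ∈ R) (φ : L.Formula ι) :
    φ.Realize (fun i => (t i).1) ↔ φ.Realize (fun i => (t i).2) := by
  have := hR (φ.relabel fun i => (⟨t i, ht i⟩ : R))
  simp only [Formula.realize_relabel] at this
  exact this

theorem isElementary_of_imp {R : Set (M × M)}
    (h : ∀ φ : L.Formula R, φ.Realize (fun p => p.1.1) → φ.Realize (fun p => p.1.2)) :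
    IsElementary L R := fun φ =>
  ⟨h φ, fun hφ => by_contra fun hn => h φ.not (Formula.realize_not.2 hn) hφ⟩

theorem isElementary_diagonal (B : Set M) : IsElementary L ((fun b => (b, b)) '' B) := by
  intro φ
  have : (fun p : ((fun b : M => (b, b)) '' B) => p.1.1) = fun p => p.1.2 := by
    funext ⟨_, b, _, rfl⟩
    rfl
  rw [this]

theorem IsElementary.swap {R : Set (M × M)} (hR : IsElementary L R) :
    IsElementary L (Prod.swap ⁻¹' R) := fun φ =>
  (hR.realize_iff (t := fun p : (Prod.swap ⁻¹' R : Set (M × M)) => p.1.swap) (fun p => p.2) φ).symm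

theorem isElementary_union_range {R : Set (M × M)} {β : Type*} {a a' : β → M}
    (h : ∀ ψ : L.Formula (R ⊕ β), ψ.Realize (Sum.elim (fun p => p.1.1) a) →
      ψ.Realize (Sum.elim (fun p => p.1.2) a')) :
    IsElementary L (R ∪ range fun j => (a j, a' j)) := by
  refine isElementary_of_imp fun φ hφ => ?_
  have : ∀ p : ↥(R ∪ range fun j => (a j, a' j)), ∃ x : R ⊕ β,
      Sum.elim (fun p => p.1.1) a x = p.1.1 ∧ Sum.elim (fun p => p.1.2) a' x = p.1.2 := by
    rintro ⟨p, hp | ⟨j, rfl⟩⟩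
    · exact ⟨Sum.inl ⟨p, hp⟩, rfl, rfl⟩
    · exact ⟨Sum.inr j, rfl, rfl⟩
  choose e he he' using this
  have := h (φ.relabel e)
  simp only [Formula.realize_relabel] at this
  rw [show Sum.elim (fun p : R => p.1.1) a ∘ e = fun p => p.1.1 from funext he,
    show Sum.elim (fun p : R => p.1.2) a' ∘ e = fun p => p.1.2 from funext he'] at this
  exact this hφ

theorem IsElementary.sUnion {c : Set (Set (M × M))} (hne : c.Nonempty)
    (hdir : DirectedOn (· ⊆ ·) c) (hc : ∀ R ∈ c, IsElementary L R) : IsElementary L (⋃₀ c) := by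
  classical
  intro φ
  -- Only finitely many variables occur in `φ`, so they all come from a single member of `c`.
  obtain ⟨R, hRc, hR⟩ := hdir.exists_mem_subset_of_finite_of_subset_sUnion hne
    (φ.freeVarFinset.finite_toSet.image Subtype.val) (by
      rintro _ ⟨p, _, rfl⟩
      exact p.2)
  have hmem : ∀ p : φ.freeVarFinset, p.1.1 ∈ R := fun p => hR ⟨p.1, p.2, rfl⟩
  let g : φ.freeVarFinset → R := fun p => ⟨p.1.1, hmem p⟩
  exact (BoundedFormula.realize_restrictFreeVar (f := g) _ fun _ => rfl).symm.trans
    ((hc R hRc (φ.restrictFreeVar g)).trans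
      (BoundedFormula.realize_restrictFreeVar (f := g) _ fun _ => rfl))

theorem IsElementary.exists_insert_right (hM : IsSaturated L M) {R : Set (M × M)}
    (hR : IsElementary L R) (hcard : #R < #M) (x : M) :
    ∃ y, IsElementary L (insert (x, y) R) := by
  -- The type that the image of `x` has to realize.
  let F : Set (Set (Fin 1 → M)) := {D | ∃ ψ : L.Formula (R ⊕ Fin 1),
    ψ.Realize (Sum.elim (fun p => p.1.1) fun _ => x) ∧
      D = {z | ψ.Realize (Sum.elim (fun p => p.1.2) z)}}
  obtain ⟨c, hc⟩ : (⋂₀ F).Nonempty := by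
    refine hM.sInter_nonempty (A := Prod.snd '' R) (Cardinal.mk_image_le.trans_lt hcard)
      ⟨_, ⊤, by simp, rfl⟩ ?_ ?_ ?_
    · rintro _ ⟨ψ, _, rfl⟩
      exact definable_realize_elim (fun p => mem_image_of_mem _ p.2) ψ
    · rintro _ ⟨ψ, hψ, rfl⟩ _ ⟨χ, hχ, rfl⟩
      refine ⟨ψ ⊓ χ, Formula.realize_inf.2 ⟨hψ, hχ⟩, ?_⟩
      ext z
      simp
    · rintro _ ⟨ψ, hψ, rfl⟩
      exact Formula.realize_iExs.1 ((hR (ψ.iExs (Fin 1))).1 (Formula.realize_iExs.2 ⟨_, hψ⟩))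
  refine ⟨c 0, ?_⟩
  have := isElementary_union_range (L := L) (R := R) (a := fun _ : Fin 1 => x) (a' := c)
    fun ψ hψ => hc _ ⟨ψ, hψ, rfl⟩
  rwa [range_unique, union_singleton] at this

theorem IsElementary.exists_insert_left (hM : IsSaturated L M) {R : Set (M × M)}
    (hR : IsElementary L R) (hcard : #R < #M) (y : M) :
    ∃ x, IsElementary L (insert (x, y) R) := by
  obtain ⟨x, hx⟩ := hR.swap.exists_insert_right hM (by
    rw [← image_swap_eq_preimage_swap]
    exact Cardinal.mk_image_le.trans_lt hcard) y
  refine ⟨x, ?_⟩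
  convert hx.swap using 1
  ext ⟨p, q⟩
  simp [and_comm]

/-- An elementary relation that is total and surjective is the graph of an automorphism. -/
theorem IsElementary.exists_equiv_of_total {R : Set (M × M)} (hR : IsElementary L R)
    (htot : ∀ x, ∃ y, (x, y) ∈ R) (hsurj : ∀ y, ∃ x, (x, y) ∈ R) :
    ∃ f : M ≃[L] M, ∀ p ∈ R, f p.1 = p.2 := by
  choose f hf using htot
  have hfun : ∀ p ∈ R, f p.1 = p.2 := by
    intro p hp
    have := hR.realize_iff (t := ![(p.1, f p.1), p]) (by
      intro i
      fin_cases i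
      exacts [hf _, hp]) ((Term.var 0).equal (Term.var 1))
    simpa [Formula.realize_equal] using this
  let g : M ↪ₑ[L] M := ⟨f, fun n φ x =>
    (hR.realize_iff (t := fun i => (x i, f (x i))) (fun i => hf _) φ).symm⟩
  have hg : Function.Bijective g := ⟨g.injective, fun y => by
    obtain ⟨x, hx⟩ := hsurj y
    exact ⟨x, hfun _ hx⟩⟩
  exact ⟨⟨Equiv.ofBijective g hg, fun F x => g.map_fun F x, fun r x => g.map_rel r x⟩, hfun⟩

/-- Strong homogeneity of saturated structures: a small elementary relation extends to an
automorphism. The automorphism is built by going back and forth along a well-order of `M` whose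
proper initial segments are small. -/
theorem IsElementary.exists_equiv (hM : IsSaturated L M) (hreg : (#M).IsRegular)
    {R : Set (M × M)} (hR : IsElementary L R) (hcard : #R < #M) :
    ∃ f : M ≃[L] M, ∀ p ∈ R, f p.1 = p.2 := by
  obtain ⟨r, wo, hr⟩ := Cardinal.exists_ord_eq M
  have step : ∀ (x : M) (Q : Set (M × M)), ∃ T : Set (M × M), #T < #M ∧
      (IsElementary L Q → #Q < #M →
        IsElementary L (Q ∪ T) ∧ (∃ y, (x, y) ∈ T) ∧ ∃ y, (y, x) ∈ T) := by
    intro x Q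
    by_cases hQ : IsElementary L Q ∧ #Q < #M
    · obtain ⟨y, hy⟩ := hQ.1.exists_insert_right hM hQ.2 x
      have hcard' : #(insert (x, y) Q : Set (M × M)) < #M :=
        Cardinal.mk_insert_le.trans_lt
          (Cardinal.add_lt_of_lt hreg.aleph0_le hQ.2 (Cardinal.one_lt_aleph0.trans_le hreg.aleph0_le))
      obtain ⟨z, hz⟩ := hy.exists_insert_left hM hcard' x
      refine ⟨{(z, x), (x, y)}, ?_, fun _ _ => ⟨?_, ⟨y, by simp⟩, ⟨z, by simp⟩⟩⟩
      · exact (toFinite _).lt_aleph0.trans_le hreg.aleph0_le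
      · rwa [union_comm, insert_union, singleton_union]
    · exact ⟨∅, by simpa using hreg.pos, fun h h' => absurd ⟨h, h'⟩ hQ⟩
  choose T hTcard hT using step
  let S : M → Set (M × M) := wo.wf.fix fun x S => T x (R ∪ ⋃ y, ⋃ hy : r y x, S y hy)
  let Q : M → Set (M × M) := fun x => R ∪ ⋃ y ∈ {y | r y x}, S y
  have hS : ∀ x, S x = T x (Q x) := fun x => wo.wf.fix_eq _ x
  have hQcard : ∀ x, #(Q x) < #M := fun x => by
    refine (Cardinal.mk_union_le _ _).trans_lt (Cardinal.add_lt_of_lt hreg.aleph0_le hcard ?_)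
    refine (Cardinal.card_biUnion_lt_iff_forall_of_isRegular hreg ?_).2 fun y _ => ?_
    · exact Cardinal.card_typein_lt x hr
    · rw [hS]
      exact hTcard _ _
  have hQmono : ∀ x y, r x y → Q x ∪ S x ⊆ Q y := fun x y hxy =>
    union_subset (union_subset_union_right _
      (biUnion_subset_biUnion_left fun z hz => _root_.trans hz hxy))
      fun q hq => Or.inr (mem_biUnion (show x ∈ {z | r z y} from hxy) hq)
  have hdir : ∀ s : Set M, DirectedOn (· ⊆ ·) (insert R ((fun y => Q y ∪ S y) '' s)) := by
    refine fun s => IsChain.directedOn ?_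
    refine IsChain.insert ?_ ?_
    · rintro _ ⟨x, _, rfl⟩ _ ⟨y, _, rfl⟩ _
      rcases trichotomous_of r x y with h | rfl | h
      · exact Or.inl ((hQmono x y h).trans subset_union_left)
      · exact Or.inl subset_rfl
      · exact Or.inr ((hQmono y x h).trans subset_union_left)
    · rintro _ ⟨x, _, rfl⟩ _
      exact Or.inl (subset_union_left.trans subset_union_left)
  have hQ : ∀ x, IsElementary L (Q x) := by
    intro x
    induction x using wo.wf.induction with
    | _ x ih =>
      have hx : Q x = ⋃₀ insert R ((fun y => Q y ∪ S y) '' {y | r y x}) := by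
        refine Subset.antisymm (union_subset (subset_sUnion_of_mem (mem_insert _ _)) ?_) ?_
        · refine iUnion₂_subset fun y hy => ?_
          exact subset_union_right.trans
            (subset_sUnion_of_mem (mem_insert_of_mem _ (mem_image_of_mem _ hy)))
        · refine sUnion_subset ?_
          rintro _ (rfl | ⟨y, hy, rfl⟩)
          exacts [subset_union_left, hQmono y x hy]
      rw [hx]
      refine IsElementary.sUnion (insert_nonempty _ _) (hdir _) ?_
      rintro _ (rfl | ⟨y, hy, rfl⟩)
      · exact hR
      · simp only [hS y]
        exact (hT y _ (ih y hy) (hQcard y)).1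
  have hstep : ∀ x, IsElementary L (Q x ∪ S x) ∧ (∃ y, (x, y) ∈ S x) ∧ ∃ y, (y, x) ∈ S x := by
    intro x
    rw [hS]
    exact hT x _ (hQ x) (hQcard x)
  have hmem : ∀ x, S x ⊆ ⋃₀ insert R ((fun y => Q y ∪ S y) '' univ) := fun x =>
    subset_union_right.trans
      (subset_sUnion_of_mem (mem_insert_of_mem _ (mem_image_of_mem _ (mem_univ x))))
  have hE := IsElementary.sUnion (L := L) (insert_nonempty _ _) (hdir univ) (by
    rintro _ (rfl | ⟨y, _, rfl⟩)
    exacts [hR, (hstep y).1])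
  obtain ⟨f, hf⟩ := hE.exists_equiv_of_total
    (fun x => (hstep x).2.1.imp fun _ h => hmem x h)
    (fun x => (hstep x).2.2.imp fun _ h => hmem x h)
  exact ⟨f, fun p hp => hf p (subset_sUnion_of_mem (mem_insert _ _) hp)⟩

end Elementary

/-! ### Morley sequences of types given by ultrafilters -/

section Coheir

variable {L : FirstOrder.Language.{u, v}} {M : Type w} [L.Structure M] {n : ℕ}

variable (L) in
/-- The tuple `a` realizes, over the parameter set `P`, the global type of the ultrafilter `𝓤`,
whose formulas are those that define a member of `𝓤`. If `𝓤` contains a set `X`, this type is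
finitely satisfiable in `X`. -/
def RealizesOver (𝓤 : Ultrafilter (Fin n → M)) (P : Set M) (a : Fin n → M) : Prop :=
  ∀ D, P.Definable L D → D ∈ 𝓤 → a ∈ D

theorem RealizesOver.mono {𝓤 : Ultrafilter (Fin n → M)} {P Q : Set M} {a : Fin n → M}
    (ha : RealizesOver L 𝓤 Q a) (hPQ : P ⊆ Q) : RealizesOver L 𝓤 P a :=
  fun D hD h => ha D (hD.mono hPQ) h

/-- The type of an ultrafilter concentrated on `X` is invariant under elementary relations that
fix the coordinates of the points of `X`, so that such a relation extends to realizations of the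
type. -/
theorem IsElementary.union_range_of_realizesOver {𝓤 : Ultrafilter (Fin n → M)}
    {X : Set (Fin n → M)} (hX : X ∈ 𝓤) {R : Set (M × M)} (hR : IsElementary L R)
    (hXR : ∀ x ∈ X, ∀ j, (x j, x j) ∈ R) {a a' : Fin n → M}
    (ha : RealizesOver L 𝓤 (Prod.fst '' R) a) (ha' : RealizesOver L 𝓤 (Prod.snd '' R) a') :
    IsElementary L (R ∪ range fun j => (a j, a' j)) := by
  refine isElementary_union_range fun ψ hψ => ?_
  have hdef : (Prod.fst '' R).Definable L
      {z : Fin n → M | ψ.Realize (Sum.elim (fun p : R => p.1.1) z)} :=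
    definable_realize_elim (fun p => mem_image_of_mem _ p.2) ψ
  have hmem : {z : Fin n → M | ψ.Realize (Sum.elim (fun p : R => p.1.1) z)} ∈ 𝓤 := by
    by_contra hn
    exact ha _ hdef.compl (Ultrafilter.compl_mem_iff_notMem.2 hn) hψ
  refine ha' {z | ψ.Realize (Sum.elim (fun p : R => p.1.2) z)}
    (definable_realize_elim (fun p => mem_image_of_mem _ p.2) ψ) ?_
  filter_upwards [hmem, hX] with z hz hzX
  have := hR.realize_iff (t := Sum.elim (fun p : R => p.1) fun j => (z j, z j)) (by
    rintro (p | j)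
    exacts [p.2, hXR z hzX j]) ψ
  rw [show (fun i => (Sum.elim (fun p : R => p.1) (fun j => (z j, z j)) i).1) =
      Sum.elim (fun p : R => p.1.1) z by ext (_ | _) <;> rfl,
    show (fun i => (Sum.elim (fun p : R => p.1) (fun j => (z j, z j)) i).2) =
      Sum.elim (fun p : R => p.1.2) z by ext (_ | _) <;> rfl] at this
  exact this.1 hz

theorem mk_union_range_lt (hinf : ℵ₀ ≤ #M) {α : Type w} {P : Set α} (hP : #P < #M)
    (a : Fin n → α) : #(P ∪ range a : Set α) < #M :=
  (Cardinal.mk_union_le _ _).trans_lt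
    (Cardinal.add_lt_of_lt hinf hP ((finite_range a).lt_aleph0.trans_le hinf))

variable (L) in
/-- A Morley sequence over `B` of the type of `𝓤`: each `a i` realizes the type over the set
`P i` of parameters consisting of `B` and the coordinates of the preceding terms. -/
structure IsMorleySequence (𝓤 : Ultrafilter (Fin n → M)) (B : Set M) (P : ℕ → Set M)
    (a : ℕ → Fin n → M) : Prop where
  zero : P 0 = B
  succ : ∀ i, P (i + 1) = P i ∪ range (a i)
  realizes : ∀ i, RealizesOver L 𝓤 (P i) (a i)

theorem exists_isMorleySequence {𝓤 : Ultrafilter (Fin n → M)} {C : Set (Fin n → M)}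
    (hinf : ℵ₀ ≤ #M)
    (hext : ∀ P : Set M, #P < #M → ∀ s : Prop, ∃ a, RealizesOver L 𝓤 P a ∧ (a ∈ C ↔ s))
    {B : Set M} (hB : #B < #M) (s : ℕ → Prop) :
    ∃ P a, IsMorleySequence L 𝓤 B P a ∧ ∀ i, a i ∈ C ↔ s i := by
  choose g hg hgC using hext
  let Q : ℕ → {P : Set M // #P < #M} := fun i => Nat.rec ⟨B, hB⟩
    (fun i P => ⟨P.1 ∪ range (g P.1 P.2 (s i)), mk_union_range_lt hinf P.2 _⟩) i
  exact ⟨fun i => (Q i).1, fun i => g (Q i).1 (Q i).2 (s i),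
    ⟨rfl, fun i => rfl, fun i => hg _ _ _⟩, fun i => hgC _ _ _⟩

/-- Two Morley sequences of the same type over a small set `B` are conjugate over `B`, up to any
finite length. -/
theorem IsMorleySequence.exists_equiv (hM : IsSaturated L M) (hreg : (#M).IsRegular)
    {𝓤 : Ultrafilter (Fin n → M)} {B : Set M} (hB : #B < #M) (hX : power n B ∈ 𝓤)
    {P P' : ℕ → Set M} {a a' : ℕ → Fin n → M}
    (h : IsMorleySequence L 𝓤 B P a) (h' : IsMorleySequence L 𝓤 B P' a') (k : ℕ) :
    ∃ f : M ≃[L] M, (∀ b ∈ B, f b = b) ∧ ∀ l < k, ∀ j, f (a l j) = a' l j := by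
  have key : ∀ i, ∃ R : Set (M × M), IsElementary L R ∧ #R < #M ∧ Prod.fst '' R ⊆ P i ∧
      Prod.snd '' R ⊆ P' i ∧ (∀ b ∈ B, (b, b) ∈ R) ∧ ∀ l < i, ∀ j, (a l j, a' l j) ∈ R := by
    intro i
    induction i with
    | zero =>
      refine ⟨_, isElementary_diagonal B, Cardinal.mk_image_le.trans_lt hB, ?_, ?_,
        fun b hb => mem_image_of_mem _ hb, by simp⟩
      · rw [h.zero]
        rintro _ ⟨_, ⟨b, hb, rfl⟩, rfl⟩
        exact hb
      · rw [h'.zero]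
        rintro _ ⟨_, ⟨b, hb, rfl⟩, rfl⟩
        exact hb
    | succ i ih =>
      obtain ⟨R, hR, hcard, hfst, hsnd, hdiag, hseq⟩ := ih
      refine ⟨_, hR.union_range_of_realizesOver hX (fun x hx j => hdiag _ (hx j))
        ((h.realizes i).mono hfst) ((h'.realizes i).mono hsnd),
        mk_union_range_lt hreg.aleph0_le hcard _, ?_, ?_, fun b hb => Or.inl (hdiag b hb), ?_⟩
      · rw [h.succ, image_union, ← range_comp]
        exact union_subset_union_left _ hfst
      · rw [h'.succ, image_union, ← range_comp]
        exact union_subset_union_left _ hsnd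
      · intro l hl j
        rcases Nat.lt_succ_iff_lt_or_eq.1 hl with hl | rfl
        exacts [Or.inl (hseq l hl j), Or.inr ⟨j, rfl⟩]
  obtain ⟨R, hR, hcard, -, -, hdiag, hseq⟩ := key k
  obtain ⟨f, hf⟩ := hR.exists_equiv hM hreg hcard
  exact ⟨f, fun b hb => hf _ (hdiag b hb), fun l hl j => hf _ (hseq l hl j)⟩

/-- If over every small parameter set the type of `𝓤` is realized both in `C` and outside `C`,
then it has Morley sequences that meet `C` in any prescribed pattern; these are conjugate, so
the orbit of `C` shatters arbitrarily long finite sequences. -/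
theorem not_hasFiniteVCDim_orbit (hM : IsSaturated L M) (hreg : (#M).IsRegular)
    {𝓤 : Ultrafilter (Fin n → M)} {C : Set (Fin n → M)}
    (hext : ∀ P : Set M, #P < #M → ∀ s : Prop, ∃ a, RealizesOver L 𝓤 P a ∧ (a ∈ C ↔ s))
    {A B : Set M} (hAB : A ⊆ B) (hB : #B < #M) (hX : power n B ∈ 𝓤) :
    ¬ HasFiniteVCDim (orbit L C A) := by
  classical
  rintro ⟨k, hk⟩
  choose P a ha haC using
    fun s : ℕ → Prop => exists_isMorleySequence hreg.aleph0_le hext hB s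
  have hconj := fun s s' => (ha s).exists_equiv hM hreg hB hX (ha s') k
  let e : Fin k → Fin n → M := fun l => a (fun _ => True) l
  have he : Function.Injective e := by
    intro l l' hll
    -- An equality between two terms would carry over to the pattern that separates them.
    obtain ⟨f, -, hf⟩ := hconj (fun _ => True) fun i => i = l
    have : a (fun i => i = l) l = a (fun i => i = l) l' := funext fun j => by
      rw [← hf l l.2 j, ← hf l' l'.2 j]
      exact congrArg (fun z => f (z j)) hll
    have h1 := (haC (fun i => i = (l : ℕ)) l).2 rfl
    rw [this, haC] at h1
    exact (Fin.ext h1).symm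
  refine hk (Finset.univ.image e) ?_ fun H hH => ?_
  · rw [Finset.card_image_of_injective _ he, Finset.card_univ, Fintype.card_fin]
  -- The trace `H` is cut out by moving the sequence whose pattern is `H` to `e`.
  let s : ℕ → Prop := fun i => ∃ h : i < k, e ⟨i, h⟩ ∈ H
  obtain ⟨f, hfB, hf⟩ := hconj s fun _ => True
  refine ⟨_, ⟨f, fun b hb => hfB b (hAB hb), rfl⟩, ?_⟩
  have hmem : ∀ l : Fin k, e l ∈ (fun (c : Fin n → M) i => f (c i)) '' C ↔ e l ∈ H := by
    intro l
    have hl : e l = fun i => f (a s l i) := funext fun i => (hf l l.2 i).symm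
    have hinj : Function.Injective fun (c : Fin n → M) i => f (c i) :=
      fun c d hcd => funext fun i => f.injective (congrFun hcd i)
    conv_lhs => rw [hl]
    rw [hinj.mem_set_image, haC]
    exact ⟨fun ⟨_, h⟩ => h, fun h => ⟨l.2, h⟩⟩
  ext z
  constructor
  · rintro ⟨hz, hzB⟩
    obtain ⟨l, -, rfl⟩ := Finset.mem_image.1 (Finset.mem_coe.1 hzB)
    exact (hmem l).1 hz
  · intro hz
    obtain ⟨l, -, rfl⟩ := Finset.mem_image.1 (Finset.mem_coe.1 (hH hz))
    exact ⟨(hmem l).2 hz, hH hz⟩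

end Coheir

/-! ### Approximation by definable subsets -/

section Approximation

variable {L : FirstOrder.Language.{u, v}} {M : Type w} [L.Structure M] {n : ℕ}

variable (L) in
/-- Saturation relative to a set `E` that need not be definable: types over small parameter sets
all of whose formulas are satisfied in `E` are realized in `E`. Types are encoded as in
`IsSaturated.sInter_nonempty`. -/
def IsSaturatedIn (E : Set (Fin n → M)) : Prop :=
  ∀ P : Set M, #P < #M → ∀ F : Set (Set (Fin n → M)), F.Nonempty →
    (∀ D ∈ F, P.Definable L D) → (∀ D ∈ F, ∀ D' ∈ F, D ∩ D' ∈ F) →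
      (∀ D ∈ F, (D ∩ E).Nonempty) → (⋂₀ F ∩ E).Nonempty

theorem IsSaturatedSet.isSaturatedIn {C : Set (Fin n → M)} (hC : IsSaturatedSet L C) :
    IsSaturatedIn L C ∧ IsSaturatedIn L Cᶜ := by
  let _ := predStructure C
  let _ := expansion L C
  have hdefC : ∀ P : Set M, P.Definable (L.sum (predLanguage n)) C := fun P =>
    definable_iff_exists_formula_sum.2
      ⟨Relations.formula (Sum.inr PredRel.mem : (L.sum (predLanguage n)).Relations n)
        fun i => Term.var (Sum.inr i), rfl⟩
  have key : ∀ E : Set (Fin n → M), (∀ P : Set M, P.Definable (L.sum (predLanguage n)) E) →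
      IsSaturatedIn L E := by
    intro E hE P hP F hF hdef hinter hne
    have : (⋂₀ ((· ∩ E) '' F)).Nonempty := by
      refine IsSaturated.sInter_nonempty hC hP (hF.image _) ?_ ?_ ?_
      · rintro _ ⟨D, hD, rfl⟩
        exact ((hdef D hD).map_expansion (LHom.sumInl : L →ᴸ L.sum (predLanguage n))).inter (hE P)
      · rintro _ ⟨D, hD, rfl⟩ _ ⟨D', hD', rfl⟩
        exact ⟨D ∩ D', hinter D hD D' hD', inter_inter_distrib_right D D' E⟩
      · rintro _ ⟨D, hD, rfl⟩
        exact hne D hD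
    obtain ⟨c, hc⟩ := this
    exact ⟨c, fun D hD => (hc _ (mem_image_of_mem _ hD)).1,
      (hc _ (mem_image_of_mem _ hF.some_mem)).2⟩
  exact ⟨key C hdefC, key Cᶜ fun P => (hdefC P).compl⟩

/-- The compactness of the space of ultrafilters on `X`: if `X` is not covered by a single
definable subset of `C`, then some ultrafilter on `X` contains no definable subset of `C`. -/
theorem exists_ultrafilter_of_not_subset {A : Set M} {X C : Set (Fin n → M)}
    (h : ∀ D, A.Definable L D → D ⊆ C → ¬ X ⊆ D) :
    ∃ 𝓤 : Ultrafilter (Fin n → M), X ∈ 𝓤 ∧ ∀ D, A.Definable L D → D ⊆ C → D ∉ 𝓤 := by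
  let G : Filter (Fin n → M) :=
    { sets := {V | ∃ D, A.Definable L D ∧ D ⊆ C ∧ X ⊆ V ∪ D}
      univ_sets := ⟨∅, by simp⟩
      sets_of_superset := by
        rintro V W ⟨D, hD, hDC, hV⟩ hVW
        exact ⟨D, hD, hDC, hV.trans (union_subset_union_left _ hVW)⟩
      inter_sets := by
        rintro V W ⟨D, hD, hDC, hV⟩ ⟨D', hD', hDC', hW⟩
        refine ⟨D ∪ D', hD.union hD', union_subset hDC hDC', fun x hx => ?_⟩
        have h1 := hV hx
        have h2 := hW hx
        simp only [mem_union, mem_inter_iff] at *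
        tauto }
  have hG : G.NeBot := ⟨fun hbot => by
    obtain ⟨D, hD, hDC, hX⟩ : ∅ ∈ G := Filter.empty_mem_iff_bot.2 hbot
    exact h D hD hDC (by rwa [empty_union] at hX)⟩
  refine ⟨Ultrafilter.of G, Ultrafilter.of_le G ⟨∅, by simp⟩, fun D hD hDC => ?_⟩
  exact Ultrafilter.compl_mem_iff_notMem.1
    (Ultrafilter.of_le G ⟨D, hD, hDC, by simp [compl_union_self]⟩)

/-- Over a small set `B`, the trace of `C` is covered by a definable subset of `C`. -/
theorem exists_definable_between (hM : IsSaturated L M) (hreg : (#M).IsRegular)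
    {C : Set (Fin n → M)} (hC : IsSaturatedIn L C) (hC' : IsSaturatedIn L Cᶜ)
    {A : Set M} (hVC : HasFiniteVCDim (orbit L C A)) {B : Set M} (hAB : A ⊆ B) (hB : #B < #M) :
    ∃ D, (univ : Set M).Definable L D ∧ C ∩ power n B ⊆ D ∧ D ⊆ C := by
  by_contra! hcon
  obtain ⟨𝓤, hX, h𝓤⟩ := exists_ultrafilter_of_not_subset
    (X := C ∩ power n B) fun D hD hDC hXD => hcon D hD hXD hDC
  refine not_hasFiniteVCDim_orbit hM hreg (𝓤 := 𝓤) (C := C) (fun P hP s => ?_) hAB hB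
    (Filter.mem_of_superset hX inter_subset_right) hVC
  have hF : ∀ E, IsSaturatedIn L E → (∀ D, (univ : Set M).Definable L D → D ∈ 𝓤 →
      (D ∩ E).Nonempty) → ∃ a ∈ E, RealizesOver L 𝓤 P a := by
    intro E hE hne
    obtain ⟨a, ha, haE⟩ := hE P hP {D | P.Definable L D ∧ D ∈ 𝓤}
      ⟨univ, definable_univ, Filter.univ_mem⟩ (fun D hD => hD.1)
      (fun D hD D' hD' => ⟨hD.1.inter hD'.1, Filter.inter_mem hD.2 hD'.2⟩)
      (fun D hD => hne D (hD.1.mono (subset_univ P)) hD.2)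
    exact ⟨a, haE, fun D hD hD𝓤 => ha D ⟨hD, hD𝓤⟩⟩
  by_cases hs : s
  · obtain ⟨a, haC, ha⟩ := hF C hC fun D hD hD𝓤 =>
      (𝓤.nonempty_of_mem (Filter.inter_mem hD𝓤 hX)).mono
        (inter_subset_inter_right _ inter_subset_left)
    exact ⟨a, ha, iff_of_true haC hs⟩
  · obtain ⟨a, haC, ha⟩ := hF Cᶜ hC' fun D hD hD𝓤 => by
      by_contra hemp
      exact h𝓤 D hD (by rwa [inter_compl_nonempty_iff, not_not] at hemp) hD𝓤
    exact ⟨a, ha, iff_of_false haC hs⟩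

theorem exists_solutions_eq {D : Set (Fin n → M)} (hD : (univ : Set M).Definable L D) :
    ∃ (m : ℕ) (φ : L.Formula (Fin m ⊕ Fin n)) (b : Fin m → M), solutions φ b = D := by
  obtain ⟨A, -, hA⟩ := definable_iff_finitely_definable.1 hD
  obtain ⟨φ, rfl⟩ := definable_iff_exists_formula_sum.1 hA
  refine ⟨_, φ.relabel (Sum.map A.equivFin id), fun i => A.equivFin.symm i, ?_⟩
  ext z
  simp only [solutions, mem_ofPred_eq, Formula.realize_relabel, Sum.elim_comp_map]
  simp only [Function.comp_def, Equiv.symm_apply_apply, id]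
  rfl

theorem mk_sigma_formula_le (L : FirstOrder.Language.{u, v}) (n : ℕ) :
    #(Σ m, L.Formula (Fin m ⊕ Fin n)) ≤ max ℵ₀ L.card := by
  have h : ∀ m, #(L.Formula (Fin m ⊕ Fin n)) ≤ max ℵ₀ L.card := fun m => by
    have hinj : Function.Injective fun φ : L.Formula (Fin m ⊕ Fin n) =>
        (⟨0, φ⟩ : Σ k, L.BoundedFormula (Fin m ⊕ Fin n) k) :=
      fun φ ψ h => by simpa using h
    refine (Cardinal.mk_le_of_injective hinj).trans (BoundedFormula.card_le.trans ?_)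
    refine max_le (le_max_left _ _) ((Cardinal.add_le_max _ _).trans ?_)
    refine max_le (max_le (le_max_of_le_left ?_) (by simp)) (le_max_left _ _)
    rw [Cardinal.lift_le_aleph0]
    exact Cardinal.mk_le_aleph0
  rw [Cardinal.mk_sigma]
  refine (Cardinal.sum_le_sum _ _ h).trans ?_
  rw [Cardinal.sum_const]
  simp

theorem approximableFromBelow (hM : IsSaturated L M) (hreg : (#M).IsRegular) (hω : ℵ₀ < #M)
    (hL : Cardinal.lift.{w} L.card < Cardinal.lift.{max u v} #M)
    {C : Set (Fin n → M)} (hC : IsSaturatedIn L C) (hC' : IsSaturatedIn L Cᶜ)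
    {A : Set M} (hA : #A < #M) (hVC : HasFiniteVCDim (orbit L C A)) :
    ApproximableFromBelow L C := by
  by_contra hcon
  simp only [ApproximableFromBelow, not_exists, not_forall] at hcon
  -- A small set `⋃ B` that defeats every formula at once.
  choose B hBfin hB using hcon
  have hcard : #(⋃ x : Σ m, L.Formula (Fin m ⊕ Fin n), B x.1 x.2 : Set M) < #M := by
    have hι := (Cardinal.lift_le.{w}.2 (mk_sigma_formula_le L n)).trans_lt
      ((Cardinal.lift_max.trans_lt (max_lt (by simpa using hω) hL)))
    rw [← Cardinal.lift_lt.{w, max u v}]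
    refine (Cardinal.mk_iUnion_le_lift _).trans_lt (lt_of_le_of_lt (mul_le_mul_right
      (ciSup_le' fun x => ?_) _) (Cardinal.mul_lt_of_lt (by simpa using hω.le) hι
        (b := ℵ₀) (by simpa using hω)))
    simpa using (hBfin x.1 x.2).lt_aleph0.le
  obtain ⟨D, hD, hCD, hDC⟩ := exists_definable_between hM hreg hC hC' hVC
    (subset_union_left (s := A) (t := ⋃ x : Σ m, L.Formula (Fin m ⊕ Fin n), B x.1 x.2))
    ((Cardinal.mk_union_le _ _).trans_lt (Cardinal.add_lt_of_lt hω.le hA hcard))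
  obtain ⟨m, φ, b, rfl⟩ := exists_solutions_eq hD
  refine hB m φ b ⟨Subset.antisymm (inter_subset_inter_left _ hDC) ?_, hDC⟩
  rintro z ⟨hzC, hzB⟩
  refine ⟨hCD ⟨hzC, fun i => Or.inr (mem_iUnion.2 ⟨⟨m, φ⟩, hzB i⟩)⟩, hzB⟩

theorem HasFiniteVCDim.orbit_compl {C : Set (Fin n → M)} {A : Set M}
    (h : HasFiniteVCDim (orbit L C A)) : HasFiniteVCDim (orbit L Cᶜ A) := by
  refine h.imp fun k hk B hB hsh => hk B hB fun H hH => ?_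
  obtain ⟨_, ⟨f, hfA, rfl⟩, hD⟩ := hsh (B \ H) sdiff_subset
  refine ⟨_, ⟨f, hfA, rfl⟩, ?_⟩
  have hbij : Function.Bijective fun (c : Fin n → M) i => f (c i) :=
    (Equiv.arrowCongr (Equiv.refl (Fin n)) f.toEquiv).bijective
  rw [image_compl_eq hbij] at hD
  ext z
  have := congrArg (z ∈ ·) hD
  have := @hH z
  simp only [mem_inter_iff, mem_compl_iff, mem_sdiff, eq_iff_iff] at *
  tauto

theorem ApproximableFromBelow.of_compl {C : Set (Fin n → M)} (h : ApproximableFromBelow L Cᶜ) :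
    ApproximableFromAbove L C := by
  obtain ⟨m, φ, h⟩ := h
  refine ⟨m, φ.not, fun B hB => ?_⟩
  obtain ⟨b, hb, hbC⟩ := h B hB
  have hsol : solutions φ.not b = (solutions φ b)ᶜ := rfl
  refine ⟨b, ?_, hsol ▸ subset_compl_comm.1 hbC⟩
  rw [hsol]
  ext z
  have := congrArg (z ∈ ·) hb
  simp only [mem_inter_iff, mem_compl_iff, eq_iff_iff] at *
  tauto

end Approximation

end ExtDef

theorem mainTheorem2 (L : FirstOrder.Language.{u, v}) (U : Type w) [L.Structure U]
    (hU : ExtDef.IsSaturated L U) (hκ : Cardinal.IsInaccessible #U)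
    (hL : Cardinal.lift.{w} L.card < Cardinal.lift.{max u v} #U)
    (n : ℕ) (C : Set (Fin n → U)) (hC : ExtDef.IsSaturatedSet L C)
    (hVC : ∃ A : Set U, #A < #U ∧ ExtDef.HasFiniteVCDim (ExtDef.orbit L C A)) :
    ExtDef.ApproximableFromBelow L C ∧ ExtDef.ApproximableFromAbove L C := by
  obtain ⟨A, hA, hVC⟩ := hVC
  obtain ⟨hCsat, hCsat'⟩ := hC.isSaturatedIn
  refine ⟨ExtDef.approximableFromBelow hU hκ.isRegular hκ.aleph0_lt hL hCsat hCsat' hA hVC, ?_⟩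
  refine (ExtDef.approximableFromBelow hU hκ.isRegular hκ.aleph0_lt hL hCsat' ?_ hA
    hVC.orbit_compl).of_compl
  rwa [compl_compl]
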